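/- \textbf{The problem.} An input of the \emph{minimum problem under uncertainty} consists of finitely many uncertainty intervals $I_1,\dots,I_n$, each of which is either trivial, $I_i=\{a_i\}$, or open, $I_i=(L_i,U_i)$ with real endpoints; a predicted value $\overline{w}_i\in I_i$ for each $i$; and a finite family $\mathcal S$ of nonempty subsets of $\{I_1,\dots,I_n\}$. The true values $w_i\in I_i$ are hidden; a query to $I_i$ reveals $w_i$. The task is to identify, for every $S\in\mathcal S$, an element of $S$ of minimum true value. An algorithm is a deterministic adaptive strategy: given the input, it makes queries sequentially, each choice depending only on the input and on the values revealed so far, never queries a trivial or previously queried interval, and after finitely many queries it outputs, for whatever true values $w_i \in I_i$, a correct answer. No time or space constraints are imposed. A set $Q$ of intervals is a \emph{feasible query set} for the true values $w$ if for every $S\in\mathcal S$ there is $I_i\in S$ such that $v_i\le v_j$ for all $I_j\in S$ and all vectors $v$ with $v_l\in I_l$ for all $l$ and $v_l=w_l$ for all $I_l\in Q$. Let $\mathrm{opt}$ be the minimum cardinality of a feasible query set for $w$. \textbf{Hop distance.} For $1\le i\le n$ let $A_i$ be the union of all sets in $\mathcal S$ that contain $I_i$. Let $h_i$ be the number of open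 intervals $I_j=(L_j,U_j)\in A_i$ such that one of $w_i,\overline{w}_i$ is $\le L_j$ and the other is $>L_j$, plus the number of open intervals $I_j=(L_j,U_j)\in A_i$ such that one of $w_i,\overline{w}_i$ is $<U_j$ and the other is $\ge U_j$, plus the number of trivial intervals $I_j=\{a_j\}\in A_i$ such that one of $w_i,\overline{w}_i$ is $<a_j$ and the other is $>a_j$. The hop distance is $k_h=\sum_{i=1}^n h_i$. \textbf{Theorem.} There is an algorithm for the minimum problem under uncertainty that, given an integer parameter $\gamma\ge 2$, achieves competitive ratio $$\min\Big\{\Big(1+\frac1\gamma\Big)\Big(1+\frac{k_h}{\mathrm{opt}}\Big),\ \gamma\Big\},$$ that is, for every input and all true values $w_i \in I_i$, the number of its queries is at most this ratio times $\mathrm{opt}$ (and no query is made if $\mathrm{opt}=0$). Furthermore, for $\gamma=2$ the same algorithm achieves competitive ratio $\min\{1.5+k_h/\mathrm{opt},\,2\}$. -/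

import Mathlib

namespace MinUncertainty

/-- An uncertainty interval: either a trivial interval `{a}` or an open interval `(L, U)`. -/
inductive UInterval where
  | point (a : ℝ)
  | ioo (L U : ℝ)

/-- The set of possible values of an uncertainty interval. -/
def UInterval.toSet : UInterval → Set ℝ
  | .point a => {a}
  | .ioo L U => Set.Ioo L U

def UInterval.IsTrivial : UInterval → Prop
  | .point _ => True
  | .ioo _ _ => False

/-- What is visible to an algorithm from the beginning: `n` uncertainty intervals, a predicted
value in each of them (so no interval is empty), and a family of nonempty sets of intervals.
Intervals are referred to by their index, so distinct intervals may occupy the same range. -/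
structure Input (n : ℕ) where
  interval : Fin n → UInterval
  pred : Fin n → ℝ
  pred_mem : ∀ i, pred i ∈ (interval i).toSet
  sets : Finset (Finset (Fin n))
  sets_nonempty : ∀ S ∈ sets, S.Nonempty

namespace Input

variable {n : ℕ} (P : Input n)

/-- `w` is a possible vector of true values. -/
def IsRealization (w : Fin n → ℝ) : Prop :=
  ∀ i, w i ∈ (P.interval i).toSet

/-- `Q` is a feasible query set for the true values `w`: once the values of the intervals in `Q`
are known, there is, in every set of the family, an element that is certain to have minimum value,
i.e. that has minimum value under every vector of values consistent with the known information. -/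
def IsFeasible (w : Fin n → ℝ) (Q : Finset (Fin n)) : Prop :=
  ∀ S ∈ P.sets, ∃ i ∈ S, ∀ v : Fin n → ℝ, P.IsRealization v → (∀ q ∈ Q, v q = w q) →
    ∀ j ∈ S, v i ≤ v j

theorem isFeasible_univ (w : Fin n → ℝ) : P.IsFeasible w Finset.univ := by
  intro S hS
  obtain ⟨i, hi, hmin⟩ := S.exists_min_image w (P.sets_nonempty S hS)
  refine ⟨i, hi, fun v _ hv j hj => ?_⟩
  rw [hv i (Finset.mem_univ i), hv j (Finset.mem_univ j)]
  exact hmin j hj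

/-- The minimum cardinality of a feasible query set; it is attained, because the set of all
intervals is a feasible query set. -/
noncomputable def opt (w : Fin n → ℝ) : ℕ :=
  sInf {k : ℕ | ∃ Q : Finset (Fin n), P.IsFeasible w Q ∧ Q.card = k}

theorem exists_card_eq_opt (w : Fin n → ℝ) :
    ∃ Q : Finset (Fin n), P.IsFeasible w Q ∧ Q.card = P.opt w := by
  have h : {k : ℕ | ∃ Q : Finset (Fin n), P.IsFeasible w Q ∧ Q.card = k}.Nonempty :=
    ⟨_, Finset.univ, P.isFeasible_univ w, rfl⟩
  exact Nat.sInf_mem h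

/-- The union of all sets of the family that contain `i`. -/
def neighbors (i : Fin n) : Finset (Fin n) :=
  (P.sets.filter (fun S => i ∈ S)).biUnion id

end Input

/-- One of `x`, `y` is `≤ L` and the other is `> L`. -/
def PassesLower (x y L : ℝ) : Prop := (x ≤ L ∧ L < y) ∨ (y ≤ L ∧ L < x)

/-- One of `x`, `y` is `< U` and the other is `≥ U`. -/
def PassesUpper (x y U : ℝ) : Prop := (x < U ∧ U ≤ y) ∨ (y < U ∧ U ≤ x)

/-- One of `x`, `y` is strictly smaller than `a` and the other is strictly larger than `a`. -/
def JumpsOver (x y a : ℝ) : Prop := (x < a ∧ a < y) ∨ (y < a ∧ a < x)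

open Classical in
/-- The contribution of the interval `J` to the hop distance of another interval with true value
`x` and predicted value `y`. -/
noncomputable def UInterval.hops (x y : ℝ) : UInterval → ℕ
  | .point a => if JumpsOver x y a then 1 else 0
  | .ioo L U => (if PassesLower x y L then 1 else 0) + (if PassesUpper x y U then 1 else 0)

/-- The hop distance between the true values `w` and the predicted values. -/
noncomputable def Input.hopDistance {n : ℕ} (P : Input n) (w : Fin n → ℝ) : ℕ :=
  ∑ i, ∑ j ∈ P.neighbors i, (P.interval j).hops (w i) (P.pred i)

/-- A deterministic adaptive query strategy over intervals indexed by `ι` with answers in `α`: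
either stop with an answer, or query an interval and go on depending on the revealed value. -/
inductive Strategy (ι α : Type) where
  | answer (a : α)
  | query (i : ι) (next : ℝ → Strategy ι α)

namespace Strategy

variable {ι α : Type}

/-- The sequence of queries that the strategy makes when the true values are `w`. -/
def queries (w : ι → ℝ) : Strategy ι α → List ι
  | answer _ => []
  | query i next => i :: queries w (next (w i))

/-- The answer of the strategy when the true values are `w`. -/
def output (w : ι → ℝ) : Strategy ι α → α
  | answer a => a
  | query i next => output w (next (w i))

end Strategy

/-- An answer to the minimum problem names an interval for every set of the family. -/
abbrev Answer {n : ℕ} (P : Input n) : Type := {S : Finset (Fin n) // S ∈ P.sets} → Fin n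

/-- A deterministic algorithm: the visible input determines an adaptive query strategy. -/
abbrev QueryAlgorithm : Type := ∀ (n : ℕ) (P : Input n), Strategy (Fin n) (Answer P)

namespace QueryAlgorithm

variable (A : QueryAlgorithm)

/-- The algorithm solves the minimum problem: whatever the true values are, it names an element of
minimum true value in every set, and it never queries an interval that is trivial or that was
queried before. -/
def SolvesMinimum : Prop :=
  ∀ (n : ℕ) (P : Input n) (w : Fin n → ℝ), P.IsRealization w →
    (∀ S : {S : Finset (Fin n) // S ∈ P.sets},
      (A n P).output w S ∈ S.1 ∧ ∀ j ∈ S.1, w ((A n P).output w S) ≤ w j) ∧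
    ((A n P).queries w).Nodup ∧
    ∀ i ∈ (A n P).queries w, ¬ (P.interval i).IsTrivial

/-- The algorithm is `ρ`-competitive, for a ratio `ρ` that may depend on the instance: on every
instance it makes at most `ρ · opt` queries. -/
def IsCompetitive (ρ : ∀ n : ℕ, Input n → (Fin n → ℝ) → ℝ) : Prop :=
  ∀ (n : ℕ) (P : Input n) (w : Fin n → ℝ), P.IsRealization w →
    (((A n P).queries w).length : ℝ) ≤ ρ n P w * (P.opt w : ℝ)

end QueryAlgorithm

end MinUncertainty

namespace MinUncertainty

/-! Every feasible query set F contains each mandatory interval. If no interval is mandatory for all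
possible values, every set is solved or is a star around its leftmost interval
(`exists_solvedBy_or_leftmost`), and F is a vertex cover of the graph formed by these stars.

The strategy queries known mandatory intervals while there are any. Otherwise it looks for an
interval o whose predicted value lies in γ - 1 adjacent prediction mandatory intervals, and which
has a further neighbor q that is another such interval or is not prediction mandatory. Then o is
queried, and so are those intervals and q unless the value of o reveals an error
(`solvableWith_of_batch`). The γ + 1 queries are paid for by γ elements of F or errors; the factor 1
+ 1/γ is needed only here.

Once no such o is left, the prediction mandatory intervals and a minimum vertex cover of the rest
are queried, after which all queries are mandatory (`solvableWith_of_card_dependents_le`). For the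
factor γ, each interval of this batch is charged to a neighbor, at most γ - 1 to each; Hall's
theorem gives distinct neighbors to the cover elements (`exists_vertexCover_injOn`).

The bounds hold against every feasible F and add up over batches (`QueryBound.of_reveal`). -/

/-- The lower limit of an uncertainty interval. -/
def UInterval.lo : UInterval → ℝ
  | .point a => a
  | .ioo L _ => L

/-- The upper limit of an uncertainty interval. -/
def UInterval.hi : UInterval → ℝ
  | .point a => a
  | .ioo _ U => U

namespace UInterval

theorem lo_le {I : UInterval} {x : ℝ} (h : x ∈ I.toSet) : I.lo ≤ x := by
  cases I with
  | point a => exact (Set.mem_singleton_iff.1 h).ge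
  | ioo L U => exact h.1.le

theorem le_hi {I : UInterval} {x : ℝ} (h : x ∈ I.toSet) : x ≤ I.hi := by
  cases I with
  | point a => exact (Set.mem_singleton_iff.1 h).le
  | ioo L U => exact h.2.le

theorem lo_lt {I : UInterval} {x : ℝ} (ht : ¬ I.IsTrivial) (h : x ∈ I.toSet) : I.lo < x := by
  cases I with
  | point a => exact absurd trivial ht
  | ioo L U => exact h.1

theorem lt_hi {I : UInterval} {x : ℝ} (ht : ¬ I.IsTrivial) (h : x ∈ I.toSet) : x < I.hi := by
  cases I with
  | point a => exact absurd trivial ht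
  | ioo L U => exact h.2

theorem mem_of_lt {I : UInterval} {x : ℝ} (ht : ¬ I.IsTrivial) (h₁ : I.lo < x) (h₂ : x < I.hi) :
    x ∈ I.toSet := by
  cases I with
  | point a => exact absurd trivial ht
  | ioo L U => exact ⟨h₁, h₂⟩

theorem hi_eq_lo {I : UInterval} (ht : I.IsTrivial) : I.hi = I.lo := by
  cases I with
  | point a => rfl
  | ioo L U => exact ht.elim

end UInterval

/-! ### Partially revealed instances. -/

namespace Input

variable {n : ℕ} (P : Input n)

abbrev lo (i : Fin n) : ℝ := (P.interval i).lo

abbrev hi (i : Fin n) : ℝ := (P.interval i).hi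

abbrev IsTrivial (i : Fin n) : Prop := (P.interval i).IsTrivial

open Classical in
/-- The intervals that may be queried. -/
noncomputable def openSet : Finset (Fin n) := Finset.univ.filter fun i => ¬ P.IsTrivial i

variable {P} in
theorem mem_openSet {i : Fin n} : i ∈ P.openSet ↔ ¬ P.IsTrivial i := by simp [openSet]

theorem pred_isRealization : P.IsRealization P.pred := P.pred_mem

/-- The instance after the true values `u` of the intervals in `B` have been revealed. -/
def reveal (B : Finset (Fin n)) (u : Fin n → ℝ) : Input n where
  interval i := if i ∈ B then .point (u i) else P.interval i
  pred i := if i ∈ B then u i else P.pred i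
  pred_mem i := by
    by_cases h : i ∈ B
    · simp [h, UInterval.toSet]
    · simpa [h] using P.pred_mem i
  sets := P.sets
  sets_nonempty := P.sets_nonempty

variable {P} {B B' : Finset (Fin n)} {u v w : Fin n → ℝ} {i j : Fin n}

theorem reveal_interval_of_mem (h : i ∈ B) : (P.reveal B u).interval i = .point (u i) := by
  simp [reveal, h]

theorem reveal_interval_of_notMem (h : i ∉ B) : (P.reveal B u).interval i = P.interval i := by
  simp [reveal, h]

theorem reveal_isTrivial_of_mem (h : i ∈ B) : (P.reveal B u).IsTrivial i := by
  rw [IsTrivial, reveal_interval_of_mem h]; trivial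

theorem reveal_isTrivial_of (h : P.IsTrivial i) : (P.reveal B u).IsTrivial i := by
  by_cases hi : i ∈ B
  · exact reveal_isTrivial_of_mem hi
  · rwa [IsTrivial, reveal_interval_of_notMem hi]

theorem notMem_of_not_isTrivial_reveal (h : ¬ (P.reveal B u).IsTrivial i) : i ∉ B :=
  fun hi => h (reveal_isTrivial_of_mem hi)

theorem lo_le_reveal_lo (hu : P.IsRealization u) : P.lo i ≤ (P.reveal B u).lo i := by
  by_cases hi : i ∈ B
  · rw [lo, lo, reveal_interval_of_mem hi]; exact UInterval.lo_le (hu i)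
  · rw [lo, lo, reveal_interval_of_notMem hi]

theorem reveal_hi_le_hi (hu : P.IsRealization u) : (P.reveal B u).hi i ≤ P.hi i := by
  by_cases hi : i ∈ B
  · rw [Input.hi, Input.hi, reveal_interval_of_mem hi]; exact UInterval.le_hi (hu i)
  · rw [Input.hi, Input.hi, reveal_interval_of_notMem hi]

theorem IsRealization.reveal (hw : P.IsRealization w) : (P.reveal B w).IsRealization w := by
  intro i
  by_cases hi : i ∈ B
  · rw [reveal_interval_of_mem hi]; rfl
  · rw [reveal_interval_of_notMem hi]; exact hw i

theorem IsRealization.eq_of_mem (hw : (P.reveal B u).IsRealization w) (hi : i ∈ B) :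
    w i = u i := by
  have := hw i
  rwa [reveal_interval_of_mem hi] at this

theorem IsRealization.of_reveal (hw : (P.reveal B u).IsRealization w)
    (hu : P.IsRealization u) : P.IsRealization w := by
  intro i
  by_cases hi : i ∈ B
  · rw [hw.eq_of_mem hi]; exact hu i
  · have := hw i
    rwa [reveal_interval_of_notMem hi] at this

theorem reveal_congr (h : ∀ i ∈ B, u i = w i) : P.reveal B u = P.reveal B w := by
  unfold reveal
  congr 1 <;> funext i <;> by_cases hi : i ∈ B <;> simp [hi, h]

theorem IsRealization.reveal_eq (hw : (P.reveal B u).IsRealization w) :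
    P.reveal B u = P.reveal B w :=
  reveal_congr fun _ hi => (hw.eq_of_mem hi).symm

theorem reveal_reveal : (P.reveal B w).reveal B' w = P.reveal (B ∪ B') w := by
  unfold reveal
  congr 1 <;> funext i <;> by_cases h : i ∈ B <;> by_cases h' : i ∈ B' <;> simp [h, h']

theorem openSet_reveal_subset : (P.reveal B u).openSet ⊆ P.openSet := by
  intro i hi
  rw [mem_openSet] at *
  exact fun h => hi (reveal_isTrivial_of h)

theorem card_openSet_reveal_lt (hi : i ∈ B) (ho : ¬ P.IsTrivial i) :
    (P.reveal B u).openSet.card < P.openSet.card := by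
  refine Finset.card_lt_card ⟨openSet_reveal_subset, fun h => ?_⟩
  exact mem_openSet.1 (h (mem_openSet.2 ho)) (reveal_isTrivial_of_mem hi)

/-- This makes the accounting additive: a batch B is paid for by `F ∩ B`, and the later queries by
`F \ B`. -/
theorem IsFeasible.reveal {F : Finset (Fin n)} (hw : P.IsRealization w) (hF : P.IsFeasible w F) :
    (P.reveal B w).IsFeasible w (F \ B) := by
  intro S hS
  obtain ⟨i, hi, h⟩ := hF S hS
  refine ⟨i, hi, fun v hv hq => h v (hv.of_reveal hw) fun q hqF => ?_⟩
  by_cases hB : q ∈ B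
  · exact hv.eq_of_mem hB
  · exact hq q (Finset.mem_sdiff.2 ⟨hqF, hB⟩)

end Input

/-! ### Composing strategies. -/

/-- There is a strategy that solves the minimum problem on `P` and whose number of queries
satisfies `R` for all true values. -/
def SolvableWith {n : ℕ} (P : Input n) (R : (Fin n → ℝ) → ℕ → Prop) : Prop :=
  ∃ s : Strategy (Fin n) (Answer P), ∀ w, P.IsRealization w →
    (∀ S : {S : Finset (Fin n) // S ∈ P.sets},
      s.output w S ∈ S.1 ∧ ∀ j ∈ S.1, w (s.output w S) ≤ w j) ∧
    (s.queries w).Nodup ∧ (∀ i ∈ s.queries w, ¬ P.IsTrivial i) ∧ R w (s.queries w).length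

section Solvable

variable {n : ℕ} {P : Input n} {R R' : (Fin n → ℝ) → ℕ → Prop}

theorem SolvableWith.mono (h : SolvableWith P R)
    (hR : ∀ w k, P.IsRealization w → R w k → R' w k) : SolvableWith P R' := by
  obtain ⟨s, hs⟩ := h
  refine ⟨s, fun w hw => ?_⟩
  obtain ⟨h₁, h₂, h₃, h₄⟩ := hs w hw
  exact ⟨h₁, h₂, h₃, hR _ _ hw h₄⟩

theorem solvableWith_of_query {i : Fin n} (hi : ¬ P.IsTrivial i)
    (h : ∀ u, P.IsRealization u → SolvableWith (P.reveal {i} u) fun w k => R w (k + 1)) :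
    SolvableWith P R := by
  have h' : ∀ x : ℝ, ∃ s : Strategy (Fin n) (Answer P), ∀ w, P.IsRealization w → w i = x →
      (∀ S : {S : Finset (Fin n) // S ∈ P.sets},
        s.output w S ∈ S.1 ∧ ∀ j ∈ S.1, w (s.output w S) ≤ w j) ∧
      (s.queries w).Nodup ∧ (∀ j ∈ s.queries w, ¬ P.IsTrivial j ∧ j ≠ i) ∧
      R w ((s.queries w).length + 1) := by
    intro x
    by_cases hx : ∃ u, P.IsRealization u ∧ u i = x
    · obtain ⟨u, hu, rfl⟩ := hx
      obtain ⟨s, hs⟩ := h u hu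
      refine ⟨s, fun w hw hwi => ?_⟩
      have hw' : (P.reveal {i} u).IsRealization w := by
        rw [Input.reveal_congr (w := w) (by simp [hwi])]
        exact hw.reveal
      obtain ⟨h₁, h₂, h₃, h₄⟩ := hs w hw'
      refine ⟨h₁, h₂, fun j hj => ⟨fun ht => h₃ j hj (Input.reveal_isTrivial_of ht), ?_⟩, h₄⟩
      rintro rfl
      exact h₃ j hj (Input.reveal_isTrivial_of_mem (Finset.mem_singleton_self j))
    -- A value outside the interval is never revealed, so any answer will do.
    · exact ⟨.answer fun _ => i, fun w hw hwi => absurd ⟨w, hw, hwi⟩ hx⟩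
  choose s hs using h'
  refine ⟨.query i s, fun w hw => ?_⟩
  obtain ⟨h₁, h₂, h₃, h₄⟩ := hs (w i) w hw rfl
  refine ⟨h₁, ?_, ?_, h₄⟩
  · exact List.nodup_cons.2 ⟨fun hmem => (h₃ i hmem).2 rfl, h₂⟩
  · intro j hj
    rcases List.mem_cons.1 hj with rfl | hj
    · exact hi
    · exact (h₃ j hj).1

theorem solvableWith_of_query_finset (B : Finset (Fin n)) :
    ∀ {P : Input n} {R : (Fin n → ℝ) → ℕ → Prop}, (∀ i ∈ B, ¬ P.IsTrivial i) →
    (∀ u, P.IsRealization u → SolvableWith (P.reveal B u) fun w k => R w (B.card + k)) →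
    SolvableWith P R := by
  induction B using Finset.induction_on with
  | empty =>
    intro P R _ h
    have h0 := h _ P.pred_isRealization
    have : P.reveal ∅ P.pred = P := by simp [Input.reveal]
    rw [this] at h0
    exact h0.mono fun w k _ hk => by simpa using hk
  | insert i B hiB ih =>
    intro P R hB h
    refine solvableWith_of_query (hB i (Finset.mem_insert_self i B)) fun u hu => ih ?_ ?_
    · intro j hj
      rw [Input.IsTrivial, Input.reveal_interval_of_notMem]
      · exact hB j (Finset.mem_insert_of_mem hj)
      · rintro hji
        rw [Finset.mem_singleton] at hji
        exact hiB (hji ▸ hj)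
    · intro v hv
      have hvP := hv.of_reveal hu
      rw [hv.reveal_eq, Input.reveal_reveal, ← Finset.insert_eq]
      refine (h v hvP).mono fun w k _ hk => ?_
      rw [Finset.card_insert_of_notMem hiB] at hk
      have : B.card + k + 1 = B.card + 1 + k := by omega
      rw [this]; exact hk

end Solvable

/-! ### Mandatory intervals and the star graph. -/

namespace Input

variable {n : ℕ} (P : Input n)

/-- For the values `w`, the minimum of the other elements of some set lies inside the `i`-th
interval, so that every feasible query set contains `i`. -/
def Mandatory (w : Fin n → ℝ) (i : Fin n) : Prop :=
  ∃ S ∈ P.sets, i ∈ S ∧ (∀ j ∈ S, j ≠ i → P.lo i < w j) ∧ ∃ j ∈ S, j ≠ i ∧ w j < P.hi i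

/-- An open interval that is mandatory whatever the true values are. -/
def KnownMandatory (i : Fin n) : Prop :=
  ¬ P.IsTrivial i ∧ ∀ w, P.IsRealization w → P.Mandatory w i

/-- The element `i` is certain to have minimum value in `S`. -/
def SolvedBy (S : Finset (Fin n)) (i : Fin n) : Prop :=
  i ∈ S ∧ ∀ j ∈ S, j ≠ i → P.hi i ≤ P.lo j

/-- The open interval `l` is leftmost in `S`, and every element of `S` that meets it is an open
interval that exceeds it on the right. -/
def Leftmost (S : Finset (Fin n)) (l : Fin n) : Prop :=
  l ∈ S ∧ ¬ P.IsTrivial l ∧ ∀ j ∈ S, j ≠ l → P.hi l ≤ P.lo j ∨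
    (¬ P.IsTrivial j ∧ P.lo l < P.lo j ∧ P.lo j < P.hi l ∧ P.hi l < P.hi j)

def Edge (l j : Fin n) : Prop :=
  ∃ S ∈ P.sets, P.Leftmost S l ∧ j ∈ S ∧ j ≠ l ∧ P.lo j < P.hi l

def Adj (i j : Fin n) : Prop := P.Edge i j ∨ P.Edge j i

variable {P} {B F : Finset (Fin n)} {S : Finset (Fin n)} {u v w : Fin n → ℝ} {i j l o p : Fin n}

theorem lo_lt_hi (h : ¬ P.IsTrivial i) : P.lo i < P.hi i :=
  (UInterval.lo_lt h (P.pred_mem i)).trans (UInterval.lt_hi h (P.pred_mem i))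

theorem IsRealization.update (hw : P.IsRealization w) (hi : ¬ P.IsTrivial i) {x : ℝ}
    (h₁ : P.lo i < x) (h₂ : x < P.hi i) : P.IsRealization (Function.update w i x) := by
  intro j
  by_cases hj : j = i
  · subst hj
    rw [Function.update_self]
    exact UInterval.mem_of_lt hi h₁ h₂
  · rw [Function.update_of_ne hj]; exact hw j

/-- If i is not in F, its value can still be moved: above `w j` if i is the claimed minimum, below
the claimed minimum otherwise. -/
theorem Mandatory.mem_of_isFeasible (hw : P.IsRealization w) (hi : ¬ P.IsTrivial i)
    (h : P.Mandatory w i) (hF : P.IsFeasible w F) : i ∈ F := by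
  by_contra hiF
  obtain ⟨S, hS, hiS, hlo, j, hjS, hji, hj⟩ := h
  obtain ⟨m, hmS, hm⟩ := hF S hS
  have hupd : ∀ x, ∀ q ∈ F, Function.update w i x q = w q := fun x q hq =>
    Function.update_of_ne (by rintro rfl; exact hiF hq) _ _
  by_cases hmi : m = i
  · subst hmi
    obtain ⟨x, hx₁, hx₂⟩ := exists_between hj
    have := hm _ (hw.update hi ((hlo j hjS hji).trans hx₁) hx₂) (hupd x) j hjS
    rw [Function.update_self, Function.update_of_ne hji] at this
    exact this.not_gt hx₁
  · obtain ⟨x, hx₁, hx₂⟩ := exists_between (lt_min (hlo m hmS hmi) (lo_lt_hi hi))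
    have := hm _ (hw.update hi hx₁ (hx₂.trans_le (min_le_right _ _))) (hupd x) i hiS
    rw [Function.update_self, Function.update_of_ne hmi] at this
    exact this.not_gt (hx₂.trans_le (min_le_left _ _))

theorem Mandatory.of_reveal (hi : i ∉ B) (h : (P.reveal B u).Mandatory w i) :
    P.Mandatory w i := by
  obtain ⟨S, hS, hiS, h₁, h₂⟩ := h
  rw [lo, reveal_interval_of_notMem hi] at h₁
  rw [Input.hi, reveal_interval_of_notMem hi] at h₂
  exact ⟨S, hS, hiS, h₁, h₂⟩

theorem Leftmost.lo_lt (h : P.Leftmost S l) (hj : j ∈ S) (hjl : j ≠ l)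
    (hw : P.IsRealization w) : P.lo l < w j := by
  refine lt_of_lt_of_le ?_ (UInterval.lo_le (hw j))
  rcases h.2.2 j hj hjl with h' | h'
  · exact (lo_lt_hi h.2.1).trans_le h'
  · exact h'.2.1

theorem Edge.spec (h : P.Edge l j) : ¬ P.IsTrivial l ∧ ¬ P.IsTrivial j ∧ P.lo l < P.lo j ∧
    P.lo j < P.hi l ∧ P.hi l < P.hi j := by
  obtain ⟨S, -, hl, hj, hjl, hlt⟩ := h
  rcases hl.2.2 j hj hjl with h' | h'
  · exact absurd hlt h'.not_gt
  · exact ⟨hl.2.1, h'⟩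

theorem Adj.symm (h : P.Adj i j) : P.Adj j i := Or.symm h

theorem Adj.not_isTrivial (h : P.Adj i j) : ¬ P.IsTrivial i := by
  rcases h with h | h
  · exact h.spec.1
  · exact h.spec.2.1

theorem Adj.ne (h : P.Adj i j) : i ≠ j := by
  rintro rfl
  rcases h with h | h <;> exact lt_irrefl _ h.spec.2.2.1

theorem Adj.mem_neighbors (h : P.Adj i j) : j ∈ P.neighbors i := by
  rcases h with ⟨S, hS, hl, hj, -⟩ | ⟨S, hS, hl, hj, -⟩
  · exact Finset.mem_biUnion.2 ⟨S, Finset.mem_filter.2 ⟨hS, hl.1⟩, hj⟩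
  · exact Finset.mem_biUnion.2 ⟨S, Finset.mem_filter.2 ⟨hS, hj⟩, hl.1⟩

/-- With both ends unqueried, l cannot be certified, because both values may lie in the overlap with
that of j smaller. No other element can be, because l may drop below it. -/
theorem Edge.mem_or_mem (h : P.Edge l j) (hw : P.IsRealization w) (hF : P.IsFeasible w F) :
    l ∈ F ∨ j ∈ F := by
  by_contra hnot
  push Not at hnot
  obtain ⟨hlF, hjF⟩ := hnot
  obtain ⟨hlt, hjt, hlo, hmid, hhi⟩ := h.spec
  obtain ⟨S, hS, hl, hj, hjl, -⟩ := h
  obtain ⟨m, hmS, hm⟩ := hF S hS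
  have hupd : ∀ i ∉ F, ∀ (x : ℝ) (w : Fin n → ℝ), ∀ q ∈ F, Function.update w i x q = w q :=
    fun i hi x w q hq => Function.update_of_ne (by rintro rfl; exact hi hq) _ _
  by_cases hml : m = l
  · subst hml
    obtain ⟨y, hy₁, hy₂⟩ := exists_between hmid
    obtain ⟨x, hx₁, hx₂⟩ := exists_between hy₁
    have hr := (hw.update hlt (hlo.trans hy₁) hy₂).update hjt hx₁ (hx₂.trans (hy₂.trans hhi))
    have := hm _ hr (fun q hq => (hupd j hjF x _ q hq).trans (hupd m hlF y _ q hq)) j hj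
    rw [Function.update_self, Function.update_of_ne hjl.symm, Function.update_self] at this
    exact this.not_gt hx₂
  · obtain ⟨x, hx₁, hx₂⟩ := exists_between (lt_min (hl.lo_lt hmS hml hw) (lo_lt_hi hlt))
    have := hm _ (hw.update hlt hx₁ (hx₂.trans_le (min_le_right _ _))) (hupd l hlF x w) l hl.1
    rw [Function.update_self, Function.update_of_ne hml] at this
    exact this.not_gt (hx₂.trans_le (min_le_left _ _))

theorem Adj.mem_or_mem (h : P.Adj i j) (hw : P.IsRealization w) (hF : P.IsFeasible w F) :
    i ∈ F ∨ j ∈ F := by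
  rcases h with h | h
  · exact h.mem_or_mem hw hF
  · exact (h.mem_or_mem hw hF).symm

/-- Without known mandatory intervals, every set is solved or has the structure of a star around
its leftmost interval. -/
theorem exists_solvedBy_or_leftmost (hP : ∀ i, ¬ P.KnownMandatory i) (hS : S ∈ P.sets) :
    (∃ i, P.SolvedBy S i) ∨ ∃ l, P.Leftmost S l ∧ ∃ j ∈ S, j ≠ l ∧ P.lo j < P.hi l := by
  by_contra! hcon
  obtain ⟨hns, hnl⟩ := hcon
  have htriv : ∀ l ∈ S, (∀ j ∈ S, P.lo l ≤ P.lo j) → ¬ P.IsTrivial l := fun l hl hmin ht =>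
    hns l ⟨hl, fun j hj _ => (UInterval.hi_eq_lo ht).le.trans (hmin j hj)⟩
  obtain ⟨l, hl, hmin⟩ := S.exists_min_image P.lo (P.sets_nonempty S hS)
  have hlt := htriv l hl hmin
  have hgt : ∀ {w}, P.IsRealization w → ∀ k ∈ S, P.lo l < w k := by
    intro w hw k hk
    by_cases hkt : P.IsTrivial k
    -- A trivial interval this far left would have minimal lower limit and solve S.
    · by_contra! hle
      refine htriv k hk (fun j hj => ?_) hkt
      exact (UInterval.lo_le (hw k)).trans (hle.trans (hmin j hj))
    · exact (hmin k hk).trans_lt (UInterval.lo_lt hkt (hw k))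
  have hleft : P.Leftmost S l := by
    refine ⟨hl, hlt, fun j hj hjl => ?_⟩
    -- An interval j that meets l in any other way makes one of them known mandatory: j if it starts
    -- together with l and ends later, l if j is trivial or ends no later.
    by_contra! hcon
    obtain ⟨hlo, hcon⟩ := hcon
    by_cases hjt : P.IsTrivial j
    · refine hP l ⟨hlt, fun w hw => ⟨S, hS, hl, fun k hk _ => hgt hw k hk, j, hj, hjl, ?_⟩⟩
      exact ((UInterval.le_hi (hw j)).trans (UInterval.hi_eq_lo hjt).le).trans_lt hlo
    by_cases hhi : P.hi l < P.hi j
    · have heq : P.lo j = P.lo l := by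
        refine le_antisymm ?_ (hmin j hj)
        by_contra! h
        exact (hcon hjt h hlo).not_gt hhi
      refine hP j ⟨hjt, fun w hw => ⟨S, hS, hj, fun k hk _ => ?_, l, hl, hjl.symm, ?_⟩⟩
      · rw [heq]; exact hgt hw k hk
      · exact (UInterval.lt_hi hlt (hw l)).trans hhi
    · refine hP l ⟨hlt, fun w hw => ⟨S, hS, hl, fun k hk _ => hgt hw k hk, j, hj, hjl, ?_⟩⟩
      exact (UInterval.lt_hi hjt (hw j)).trans_le (not_lt.1 hhi)
  exact hns l ⟨hl, hnl l hleft⟩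

end Input

/-! ### Prediction errors and prediction mandatory intervals. -/

section Errors

variable {n : ℕ} {P : Input n} {B F S : Finset (Fin n)} {u v w : Fin n → ℝ} {i j l o p : Fin n}

theorem PassesLower.symm {x y L : ℝ} (h : PassesLower x y L) : PassesLower y x L := Or.symm h

theorem PassesUpper.symm {x y U : ℝ} (h : PassesUpper x y U) : PassesUpper y x U := Or.symm h

namespace Input

open Classical in
/-- The pairs `(i, j)` such that the true value and the predicted value of `i` are separated by a
limit of the neighboring open interval `j`. -/
noncomputable def errors (P : Input n) (w : Fin n → ℝ) : Finset (Fin n × Fin n) :=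
  Finset.univ.filter fun e => e.2 ∈ P.neighbors e.1 ∧ ¬ P.IsTrivial e.2 ∧
    (PassesLower (w e.1) (P.pred e.1) (P.lo e.2) ∨ PassesUpper (w e.1) (P.pred e.1) (P.hi e.2))

theorem mem_errors {e : Fin n × Fin n} : e ∈ P.errors w ↔
    e.2 ∈ P.neighbors e.1 ∧ ¬ P.IsTrivial e.2 ∧
    (PassesLower (w e.1) (P.pred e.1) (P.lo e.2) ∨
      PassesUpper (w e.1) (P.pred e.1) (P.hi e.2)) := by
  simp [errors]

theorem card_errors_le (P : Input n) (w : Fin n → ℝ) :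
    (P.errors w).card ≤ P.hopDistance w := by
  classical
  unfold errors hopDistance
  rw [Finset.card_filter, Fintype.sum_prod_type]
  refine Finset.sum_le_sum fun i _ => ?_
  rw [← Finset.sum_subset (Finset.subset_univ (P.neighbors i))]
  · refine Finset.sum_le_sum fun j _ => ?_
    dsimp only
    split_ifs with h
    · obtain ⟨-, ht, h⟩ := h
      unfold IsTrivial lo Input.hi at *
      cases hI : P.interval j with
      | point a => rw [hI] at ht; exact absurd trivial ht
      | ioo L U =>
        rw [hI] at h
        rcases h with h | h
        · have h' : PassesLower (w i) (P.pred i) L := h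
          simp [UInterval.hops, h']
        · have h' : PassesUpper (w i) (P.pred i) U := h
          simp [UInterval.hops, h']
    · exact Nat.zero_le _
  · intro j _ hj
    rw [if_neg]
    exact fun h => hj h.1

-- A revealed interval has no error of its own and, being trivial, causes none. Hop distance itself
-- could grow, since a revealed point can be jumped over; hence `errors` ignores trivial neighbors.
open Classical in
theorem card_errors_reveal (P : Input n) (B : Finset (Fin n)) (w : Fin n → ℝ) :
    ((P.reveal B w).errors w).card +
      ((P.errors w).filter fun e => e.1 ∈ B ∨ e.2 ∈ B).card ≤ (P.errors w).card := by
  rw [← Finset.card_union_of_disjoint]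
  · refine Finset.card_le_card (Finset.union_subset (fun e he => ?_) (Finset.filter_subset _ _))
    obtain ⟨h₁, h₂, h₃⟩ := mem_errors.1 he
    have h2 := notMem_of_not_isTrivial_reveal h₂
    rw [IsTrivial, reveal_interval_of_notMem h2] at h₂
    rw [lo, Input.hi, reveal_interval_of_notMem h2] at h₃
    by_cases h1 : e.1 ∈ B
    · exfalso
      have : (P.reveal B w).pred e.1 = w e.1 := by simp [Input.reveal, h1]
      rw [this] at h₃
      rcases h₃ with (h | h) | (h | h) <;> linarith [h.1, h.2]
    · have : (P.reveal B w).pred e.1 = P.pred e.1 := by simp [Input.reveal, h1]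
      rw [this] at h₃
      exact mem_errors.2 ⟨h₁, h₂, h₃⟩
  · rw [Finset.disjoint_left]
    rintro e he he'
    obtain ⟨h₁, h₂, h₃⟩ := mem_errors.1 he
    have h2 := notMem_of_not_isTrivial_reveal h₂
    rcases (Finset.mem_filter.1 he').2 with h1 | h1
    · have : (P.reveal B w).pred e.1 = w e.1 := by simp [Input.reveal, h1]
      rw [this] at h₃
      rcases h₃ with (h | h) | (h | h) <;> linarith [h.1, h.2]
    · exact h2 h1

/-- Either some value of another element has crossed the lower limit of i, or the value below the
upper limit has left across it. -/
theorem Mandatory.exists_passes (h : P.Mandatory u i) (h' : ¬ P.Mandatory v i) :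
    ∃ k, i ∈ P.neighbors k ∧
      (PassesLower (u k) (v k) (P.lo i) ∨ PassesUpper (u k) (v k) (P.hi i)) := by
  obtain ⟨S, hS, hi, h₁, j, hj, hji, hlt⟩ := h
  have hnb : ∀ k ∈ S, i ∈ P.neighbors k := fun k hk =>
    Finset.mem_biUnion.2 ⟨S, Finset.mem_filter.2 ⟨hS, hk⟩, hi⟩
  by_cases hlow : ∀ k ∈ S, k ≠ i → P.lo i < v k
  · refine ⟨j, hnb j hj, Or.inr (Or.inl ⟨hlt, ?_⟩)⟩
    by_contra! hv
    exact h' ⟨S, hS, hi, hlow, j, hj, hji, hv⟩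
  · push Not at hlow
    obtain ⟨k, hk, hki, hv⟩ := hlow
    exact ⟨k, hnb k hk, Or.inl (Or.inr ⟨hv, h₁ k hk hki⟩)⟩

theorem exists_error_of_mandatory_pred (hi : ¬ P.IsTrivial i) (h : P.Mandatory P.pred i)
    (h' : ¬ P.Mandatory w i) : ∃ k, (k, i) ∈ P.errors w := by
  obtain ⟨k, hk, hp⟩ := h.exists_passes h'
  exact ⟨k, mem_errors.2 ⟨hk, hi, hp.imp PassesLower.symm PassesUpper.symm⟩⟩

theorem exists_error_of_mandatory (hi : ¬ P.IsTrivial i) (h : P.Mandatory w i)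
    (h' : ¬ P.Mandatory P.pred i) : ∃ k, (k, i) ∈ P.errors w := by
  obtain ⟨k, hk, hp⟩ := h.exists_passes h'
  exact ⟨k, mem_errors.2 ⟨hk, hi, hp⟩⟩

open Classical in
/-- The open intervals that are mandatory if all predictions are correct. -/
noncomputable def predMandatory (P : Input n) : Finset (Fin n) :=
  Finset.univ.filter fun i => ¬ P.IsTrivial i ∧ P.Mandatory P.pred i

theorem mem_predMandatory : i ∈ P.predMandatory ↔ ¬ P.IsTrivial i ∧ P.Mandatory P.pred i := by
  simp [predMandatory]

open Classical in
/-- The prediction mandatory intervals adjacent to `o` that contain the predicted value of `o`. -/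
noncomputable def dependents (P : Input n) (o : Fin n) : Finset (Fin n) :=
  P.predMandatory.filter fun p => P.Adj o p ∧ P.lo p < P.pred o ∧ P.pred o < P.hi p

theorem mem_dependents : p ∈ P.dependents o ↔
    p ∈ P.predMandatory ∧ P.Adj o p ∧ P.lo p < P.pred o ∧ P.pred o < P.hi p := by
  simp [dependents]

/-- The witnessing set is an unsolved star. If p is its center, o is the element predicted inside p;
otherwise o is the center. -/
theorem exists_mem_dependents (hP : ∀ i, ¬ P.KnownMandatory i) (hp : p ∈ P.predMandatory) :
    ∃ o, p ∈ P.dependents o := by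
  obtain ⟨hpt, S, hS, hpS, h₁, j, hj, hjp, hjlt⟩ := mem_predMandatory.1 hp
  rcases exists_solvedBy_or_leftmost hP hS with ⟨i, hi, hsol⟩ | ⟨l, hl, -⟩
  · exfalso
    by_cases hip : i = p
    · subst hip
      exact ((hsol j hj hjp).trans (UInterval.lo_le (P.pred_mem j))).not_gt hjlt
    · exact ((UInterval.le_hi (P.pred_mem i)).trans (hsol p hpS (Ne.symm hip))).not_gt (h₁ i hi hip)
  · by_cases hlp : l = p
    · subst hlp
      have hlo : P.lo j < P.hi l := (UInterval.lo_le (P.pred_mem j)).trans_lt hjlt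
      exact ⟨j, mem_dependents.2 ⟨hp, Or.inr ⟨S, hS, hl, hj, hjp, hlo⟩, h₁ j hj hjp, hjlt⟩⟩
    · have hlt : P.pred l < P.hi l := UInterval.lt_hi hl.2.1 (P.pred_mem l)
      have he : P.Edge l p := ⟨S, hS, hl, hpS, Ne.symm hlp, (h₁ l hl.1 hlp).trans hlt⟩
      exact ⟨l, mem_dependents.2 ⟨hp, Or.inl he, h₁ l hl.1 hlp, hlt.trans he.spec.2.2.2.2⟩⟩

/-- If p is the center of the star, p itself works. If o is the center, the other element with
smallest lower limit works, since nothing but o can fall below that limit. -/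
theorem exists_dependent_forall_mandatory (hp : p ∈ P.dependents o) :
    ∃ q ∈ P.dependents o, ∀ w, P.IsRealization w → P.lo q < w o → w o < P.hi q →
      P.Mandatory w q := by
  obtain ⟨hpm, hadj, h₁, h₂⟩ := mem_dependents.1 hp
  rcases hadj with he | he
  · obtain ⟨S, hS, hl, hpS, hpo, -⟩ := he
    obtain ⟨q, hq, hmin⟩ := (S.erase o).exists_min_image P.lo ⟨p, Finset.mem_erase.2 ⟨hpo, hpS⟩⟩
    obtain ⟨hqo, hqS⟩ := Finset.mem_erase.1 hq
    have hlo : P.lo q < P.pred o := (hmin p (Finset.mem_erase.2 ⟨hpo, hpS⟩)).trans_lt h₁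
    have hhi : P.pred o < P.hi o := UInterval.lt_hi hl.2.1 (P.pred_mem o)
    have heq : P.Edge o q := ⟨S, hS, hl, hqS, hqo, hlo.trans hhi⟩
    obtain ⟨-, hqt, -, hmid, hhi'⟩ := heq.spec
    have key : ∀ w, P.IsRealization w → P.lo q < w o → w o < P.hi q → P.Mandatory w q := by
      intro w hw hw₁ hw₂
      refine ⟨S, hS, hqS, fun k hk hkq => ?_, o, hl.1, hqo.symm, hw₂⟩
      by_cases hko : k = o
      · rwa [hko]
      · rcases hl.2.2 k hk hko with h | h
        · exact hmid.trans_le (h.trans (UInterval.lo_le (hw k)))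
        · exact (hmin k (Finset.mem_erase.2 ⟨hko, hk⟩)).trans_lt (UInterval.lo_lt h.1 (hw k))
    have hhi'' := hhi.trans hhi'
    exact ⟨q, mem_dependents.2 ⟨mem_predMandatory.2
      ⟨hqt, key _ P.pred_isRealization hlo hhi''⟩, Or.inl heq, hlo, hhi''⟩, key⟩
  · refine ⟨p, hp, fun w hw _ hw₂ => ?_⟩
    obtain ⟨S, hS, hl, hoS, hop, -⟩ := he
    exact ⟨S, hS, hl.1, fun k hk hkp => hl.lo_lt hk hkp hw, o, hoS, hop, hw₂⟩

end Input

end Errors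

/-! ### Vertex covers and Hall's theorem. -/

/-- A minimum vertex cover of the part of a graph that avoids `A` can be injected into that part
along edges. -/
theorem exists_vertexCover_injOn {α : Type*} [Fintype α] [DecidableEq α] (r : α → α → Prop)
    (hr : ∀ i j, r i j → r j i) (A : Finset α) :
    ∃ C : Finset α, Disjoint C A ∧ (∀ i ∉ A, ∀ j ∉ A, r i j → i ∈ C ∨ j ∈ C) ∧
      (∀ F : Finset α, (∀ i ∉ A, ∀ j ∉ A, r i j → i ∈ F ∨ j ∈ F) →
        C.card ≤ (F \ A).card) ∧
      ∃ φ : α → α, Set.InjOn φ C ∧ ∀ q ∈ C, φ q ∉ A ∧ r q (φ q) := by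
  classical
  let IsCover : Finset α → Prop := fun F => ∀ i ∉ A, ∀ j ∉ A, r i j → i ∈ F ∨ j ∈ F
  obtain ⟨C₀, hC₀, hmin₀⟩ := (Finset.univ.filter IsCover).exists_min_image Finset.card
    ⟨Finset.univ, by simp [IsCover]⟩
  have hsd : ∀ F, IsCover F → IsCover (F \ A) := fun F hF i hi j hj hij =>
    (hF i hi j hj hij).imp (fun h => Finset.mem_sdiff.2 ⟨h, hi⟩)
      (fun h => Finset.mem_sdiff.2 ⟨h, hj⟩)
  set C := C₀ \ A with hC
  have hcov : IsCover C := hsd _ (Finset.mem_filter.1 hC₀).2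
  have hmin : ∀ F, IsCover F → C.card ≤ F.card := fun F hF =>
    (Finset.card_le_card Finset.sdiff_subset).trans
      (hmin₀ F (Finset.mem_filter.2 ⟨Finset.mem_univ _, hF⟩))
  have hCA : ∀ i ∈ C, i ∉ A := fun i hi => (Finset.mem_sdiff.1 hi).2
  refine ⟨C, Finset.sdiff_disjoint, hcov, fun F hF => hmin _ (hsd F hF), ?_⟩
  let N : α → Finset α := fun q => Finset.univ.filter fun v => v ∉ A ∧ r q v
  have hall : ∀ T : Finset C, T.card ≤ (T.biUnion fun q => N q).card := by
    intro T
    set T' : Finset α := T.image Subtype.val with hT'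
    have hTC : T' ⊆ C := by
      intro i hi
      obtain ⟨⟨q, hq⟩, -, rfl⟩ := Finset.mem_image.1 hi
      exact hq
    have hcard : T'.card = T.card := Finset.card_image_of_injective _ Subtype.val_injective
    have hbi : (T.biUnion fun q => N q) = T'.biUnion N := by
      rw [hT', Finset.image_biUnion]
    rw [← hcard, hbi]
    -- Hall's condition for `T'`: exchanging the independent part I for its neighbors keeps a cover,
    -- so minimality gives `|I| ≤ |N(I)|`. The rest of `T'` has neighbors in `T'`, hence lies in
    -- `N(T')`, and it is disjoint from `N(I)`.
    set I := T'.filter fun a => ∀ b ∈ T', ¬ r a b with hI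
    have hIT : I ⊆ T' := Finset.filter_subset _ _
    have hcov' : IsCover ((C \ I) ∪ I.biUnion N) := by
      have key : ∀ i ∉ A, ∀ j ∉ A, r i j → i ∈ C →
          i ∈ (C \ I) ∪ I.biUnion N ∨ j ∈ (C \ I) ∪ I.biUnion N := by
        intro i hi j hj hij hiC
        by_cases hiI : i ∈ I
        · refine Or.inr (Finset.mem_union_right _ (Finset.mem_biUnion.2 ⟨i, hiI, ?_⟩))
          exact Finset.mem_filter.2 ⟨Finset.mem_univ _, hj, hij⟩
        · exact Or.inl (Finset.mem_union_left _ (Finset.mem_sdiff.2 ⟨hiC, hiI⟩))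
      intro i hi j hj hij
      rcases hcov i hi j hj hij with h | h
      · exact key i hi j hj hij h
      · exact (key j hj i hi (hr _ _ hij) h).symm
    have h₁ := (hmin _ hcov').trans (Finset.card_union_le _ _)
    have h₂ := Finset.card_sdiff_add_card_eq_card (hIT.trans hTC)
    have h₃ := Finset.card_sdiff_add_card_eq_card hIT
    have h₄ : ((T' \ I) ∪ I.biUnion N).card = (T' \ I).card + (I.biUnion N).card := by
      refine Finset.card_union_of_disjoint (Finset.disjoint_left.2 fun i hi hi' => ?_)
      obtain ⟨a, ha, hai⟩ := Finset.mem_biUnion.1 hi'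
      exact (Finset.mem_filter.1 ha).2 i (Finset.mem_sdiff.1 hi).1 (Finset.mem_filter.1 hai).2.2
    have h₅ : (T' \ I) ∪ I.biUnion N ⊆ T'.biUnion N := by
      refine Finset.union_subset (fun i hi => ?_) (Finset.biUnion_subset_biUnion_of_subset_left _ hIT)
      obtain ⟨hiT, hiI⟩ := Finset.mem_sdiff.1 hi
      have : ∃ b ∈ T', r i b := by
        by_contra! h
        exact hiI (Finset.mem_filter.2 ⟨hiT, h⟩)
      obtain ⟨b, hb, hib⟩ := this
      exact Finset.mem_biUnion.2 ⟨b, hb,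
        Finset.mem_filter.2 ⟨Finset.mem_univ _, hCA i (hTC hiT), hr _ _ hib⟩⟩
    have h₆ := Finset.card_le_card h₅
    omega
  obtain ⟨f, hf, hfN⟩ := (Finset.all_card_le_biUnion_card_iff_exists_injective _).1 hall
  refine ⟨fun q => if h : q ∈ C then f ⟨q, h⟩ else q, ?_, ?_⟩
  · intro a ha b hb hab
    rw [Finset.mem_coe] at ha hb
    simp only [ha, hb, dif_pos] at hab
    exact congrArg Subtype.val (hf hab)
  · intro q hq
    simp only [hq, dif_pos]
    exact (Finset.mem_filter.1 (hfN ⟨q, hq⟩)).2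

/-! ### Forced queries and the accounting of batches. -/

section Finish

variable {n : ℕ} {P : Input n} {B F S : Finset (Fin n)} {u v w : Fin n → ℝ}
  {i j l o p q : Fin n}

/-- Enough queries have been made in `S` for the rest to be forced: as long as `S` is not solved,
it contains a known mandatory interval. -/
def Input.Settled (P : Input n) (S : Finset (Fin n)) : Prop :=
  ∃ l ∈ S, ∀ j ∈ S, j ≠ l →
    P.IsTrivial j ∨ (P.IsTrivial l ∧ P.hi l < P.hi j) ∨ P.hi l ≤ P.lo j

namespace Input

theorem Settled.reveal (hu : P.IsRealization u) (h : P.Settled S) :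
    (P.reveal B u).Settled S := by
  obtain ⟨l, hl, h⟩ := h
  refine ⟨l, hl, fun j hj hjl => ?_⟩
  by_cases hjB : j ∈ B
  · exact Or.inl (reveal_isTrivial_of_mem hjB)
  rcases h j hj hjl with h | ⟨h₁, h₂⟩ | h
  · exact Or.inl (reveal_isTrivial_of h)
  · refine Or.inr (Or.inl ⟨reveal_isTrivial_of h₁, (reveal_hi_le_hi hu).trans_lt ?_⟩)
    rwa [Input.hi, Input.hi, reveal_interval_of_notMem hjB]
  · exact Or.inr (Or.inr ((reveal_hi_le_hi hu).trans (h.trans (lo_le_reveal_lo hu))))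

theorem Settled.exists_solvedBy (hP : ∀ i, ¬ P.KnownMandatory i) (hS : S ∈ P.sets)
    (h : P.Settled S) : ∃ i, P.SolvedBy S i := by
  rcases exists_solvedBy_or_leftmost hP hS with hs | ⟨l, hl, j, hj, hjl, hlt⟩
  · exact hs
  exfalso
  obtain ⟨a, ha, h⟩ := h
  by_cases hal : a = l
  · subst hal
    rcases hl.2.2 j hj hjl with h' | h'
    · exact h'.not_gt hlt
    · rcases h j hj hjl with h'' | h'' | h''
      · exact h'.1 h''
      · exact hl.2.1 h''.1
      · exact h''.not_gt hlt
  · have hlo := lo_lt_hi hl.2.1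
    have hahi : P.lo a ≤ P.hi a :=
      (UInterval.lo_le (P.pred_mem a)).trans (UInterval.le_hi (P.pred_mem a))
    rcases h l hl.1 (Ne.symm hal) with h'' | ⟨h₁, h₂⟩ | h''
    · exact hl.2.1 h''
    · rcases hl.2.2 a ha hal with h' | h'
      · linarith
      · exact h'.1 h₁
    · rcases hl.2.2 a ha hal with h' | h'
      · linarith
      · linarith [h'.2.1]

/-- In a star around l, each edge has a revealed end: j is trivial, or l is trivial and j reaches
further right. -/
theorem settled_reveal_of_cover (hP : ∀ i, ¬ P.KnownMandatory i) (hu : P.IsRealization u)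
    (hB : ∀ i j, P.Adj i j → i ∈ B ∨ j ∈ B) (hS : S ∈ P.sets) : (P.reveal B u).Settled S := by
  rcases exists_solvedBy_or_leftmost hP hS with ⟨i, hi, hsol⟩ | ⟨l, hl, -⟩
  · exact Settled.reveal hu ⟨i, hi, fun j hj hji => Or.inr (Or.inr (hsol j hj hji))⟩
  refine ⟨l, hl.1, fun j hj hjl => ?_⟩
  by_cases hjB : j ∈ B
  · exact Or.inl (reveal_isTrivial_of_mem hjB)
  rcases hl.2.2 j hj hjl with h | h
  · exact Or.inr (Or.inr ((reveal_hi_le_hi hu).trans (h.trans (lo_le_reveal_lo hu))))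
  · have hlB : l ∈ B :=
      (hB l j (Or.inl ⟨S, hS, hl, hj, hjl, h.2.2.1⟩)).resolve_right hjB
    refine Or.inr (Or.inl ⟨reveal_isTrivial_of_mem hlB, (reveal_hi_le_hi hu).trans_lt ?_⟩)
    rw [Input.hi, Input.hi, reveal_interval_of_notMem hjB]
    exact h.2.2.2

end Input

/-- Being settled survives further queries, so known mandatory intervals are queried until all sets
are solved. M collects these queries, each of them mandatory already in the initial instance. -/
theorem solvableWith_of_settled : ∀ (m : ℕ) (P : Input n), P.openSet.card = m →
    (∀ S ∈ P.sets, P.Settled S) →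
    SolvableWith P fun w k => ∃ M : Finset (Fin n), M.card = k ∧
      ∀ i ∈ M, ¬ P.IsTrivial i ∧ P.Mandatory w i := by
  intro m
  induction m using Nat.strong_induction_on with
  | _ m ih =>
    intro P hm hset
    by_cases hP : ∃ i, P.KnownMandatory i
    · obtain ⟨i, hi, hman⟩ := hP
      refine solvableWith_of_query hi fun u hu => ?_
      have hlt : (P.reveal {i} u).openSet.card < m :=
        hm ▸ Input.card_openSet_reveal_lt (Finset.mem_singleton_self i) hi
      refine (ih _ hlt (P.reveal {i} u) rfl fun S hS => (hset S hS).reveal hu).mono ?_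
      rintro w k hw ⟨M, hMk, hM⟩
      have hM' : ∀ j ∈ M, j ∉ ({i} : Finset (Fin n)) := fun j hj =>
        Input.notMem_of_not_isTrivial_reveal (hM j hj).1
      have hiM : i ∉ M := fun h => hM' i h (Finset.mem_singleton_self i)
      refine ⟨insert i M, by rw [Finset.card_insert_of_notMem hiM, hMk], fun j hj => ?_⟩
      rcases Finset.mem_insert.1 hj with rfl | hj
      · exact ⟨hi, hman w (hw.of_reveal hu)⟩
      · exact ⟨fun ht => (hM j hj).1 (Input.reveal_isTrivial_of ht),
          (hM j hj).2.of_reveal (hM' j hj)⟩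
    · push Not at hP
      have hsol := fun S : {S : Finset (Fin n) // S ∈ P.sets} =>
        (hset S.1 S.2).exists_solvedBy hP S.2
      choose a ha using hsol
      refine ⟨.answer a, fun w hw => ⟨fun S => ⟨(ha S).1, fun j hj => ?_⟩, ?_, ?_, ∅, rfl, ?_⟩⟩
      · by_cases hja : j = a S
        · rw [hja]; rfl
        · exact (UInterval.le_hi (hw _)).trans
            (((ha S).2 j hj hja).trans (UInterval.lo_le (hw j)))
      · exact List.nodup_nil
      · intro i hi; exact absurd hi List.not_mem_nil
      · simp

/-- The query bounds, relative to an arbitrary feasible query set. -/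
def QueryBound (γ : ℕ) (P : Input n) (w : Fin n → ℝ) (k : ℕ) : Prop :=
  ∀ F, P.IsFeasible w F → k ≤ γ * F.card ∧
    γ * k ≤ (γ + 1) * (F.card + (P.errors w).card) ∧
    (γ = 2 → 2 * k ≤ 3 * F.card + 2 * (P.errors w).card)

open Classical in
/-- A batch of queries that respects the bounds can be put before the remaining queries. -/
theorem QueryBound.of_reveal {γ k : ℕ} (hw : P.IsRealization w)
    (hk : QueryBound γ (P.reveal B w) w k)
    (hB : ∀ F, P.IsFeasible w F → ∃ f e, f ≤ (F ∩ B).card ∧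
      e ≤ ((P.errors w).filter fun x => x.1 ∈ B ∨ x.2 ∈ B).card ∧
      B.card ≤ γ * f ∧ γ * B.card ≤ (γ + 1) * (f + e) ∧
      (γ = 2 → 2 * B.card ≤ 3 * f + 2 * e)) :
    QueryBound γ P w (B.card + k) := by
  intro F hF
  obtain ⟨f, e, hf, he, h₁, h₂, h₃⟩ := hB F hF
  obtain ⟨k₁, k₂, k₃⟩ := hk _ (hF.reveal hw)
  have hE := P.card_errors_reveal B w
  have hFc := Finset.card_sdiff_add_card_inter F B
  have hF' : (F \ B).card + f ≤ F.card := by omega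
  have hE' : ((P.reveal B w).errors w).card + e ≤ (P.errors w).card := by omega
  refine ⟨?_, ?_, fun hγ => ?_⟩
  · nlinarith [Nat.mul_le_mul_left γ hF']
  · nlinarith [Nat.mul_le_mul_left (γ + 1) (Nat.add_le_add hF' hE')]
  · have := k₃ hγ
    have := h₃ hγ
    omega

end Finish

/-! ### The algorithm and its query count. -/

section Algorithm

variable {n : ℕ} {P : Input n} {B F S D : Finset (Fin n)} {u v w : Fin n → ℝ}
  {i j l o p q : Fin n} {γ : ℕ}

/-- The last phase makes at most `|F|` plus the number of errors queries, without any loss. The two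
hypotheses serve only the factor γ: `hD'` leaves room for one cover element charged to o besides its
dependents. -/
theorem solvableWith_of_card_dependents_le (hγ : 2 ≤ γ) (hP : ∀ i, ¬ P.KnownMandatory i)
    (hD : ∀ o, (P.dependents o).card + 1 ≤ γ)
    (hD' : ∀ o q, P.Adj q o → q ∉ P.predMandatory → (P.dependents o).card + 2 ≤ γ) :
    SolvableWith P (QueryBound γ P) := by
  classical
  obtain ⟨C, hCA, hcov, hmin, φ, hφ, hφr⟩ :=
    exists_vertexCover_injOn P.Adj (fun _ _ h => h.symm) P.predMandatory
  have hCA' : ∀ q ∈ C, q ∉ P.predMandatory := fun q hq => Finset.disjoint_left.1 hCA hq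
  set X := P.predMandatory ∪ C with hX
  have hXopen : ∀ i ∈ X, ¬ P.IsTrivial i := by
    intro i hi
    rcases Finset.mem_union.1 hi with h | h
    · exact (Input.mem_predMandatory.1 h).1
    · exact (hφr i h).2.not_isTrivial
  have hXcov : ∀ i j, P.Adj i j → i ∈ X ∨ j ∈ X := by
    intro i j hij
    by_cases hi : i ∈ P.predMandatory
    · exact Or.inl (Finset.mem_union_left _ hi)
    by_cases hj : j ∈ P.predMandatory
    · exact Or.inr (Finset.mem_union_left _ hj)
    · exact (hcov i hi j hj hij).imp (Finset.mem_union_right _) (Finset.mem_union_right _)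
  have hpart : ∀ x, ∃ y, x ∈ X → (x ∈ P.predMandatory ∧ x ∈ P.dependents y) ∨
      (x ∈ C ∧ y = φ x) := by
    intro x
    by_cases hx : x ∈ P.predMandatory
    · obtain ⟨o, ho⟩ := Input.exists_mem_dependents hP hx
      exact ⟨o, fun _ => Or.inl ⟨hx, ho⟩⟩
    · exact ⟨φ x, fun h => Or.inr ⟨(Finset.mem_union.1 h).resolve_left hx, rfl⟩⟩
  -- The map g sends each queried interval to the neighbor it is charged to.
  choose g hg using hpart
  have hgadj : ∀ x ∈ X, P.Adj x (g x) := by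
    intro x hx
    rcases hg x hx with ⟨-, h⟩ | ⟨h, h'⟩
    · exact (Input.mem_dependents.1 h).2.1.symm
    · rw [h']; exact (hφr x h).2
  have hfib : ∀ o, (X.filter fun x => g x = o).card + 1 ≤ γ := by
    intro o
    by_cases ho : ∃ q ∈ C, φ q = o
    · obtain ⟨q, hq, rfl⟩ := ho
      have hsub : (X.filter fun x => g x = φ q) ⊆ insert q (P.dependents (φ q)) := by
        intro x hx
        obtain ⟨hxX, hgx⟩ := Finset.mem_filter.1 hx
        rcases hg x hxX with ⟨-, h⟩ | ⟨h, h'⟩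
        · exact Finset.mem_insert_of_mem (hgx ▸ h)
        · exact Finset.mem_insert.2 (Or.inl (hφ h hq (h'.symm.trans hgx)))
      have h₁ := (Finset.card_le_card hsub).trans (Finset.card_insert_le _ _)
      have h₂ := hD' (φ q) q (hφr q hq).2 (hCA' q hq)
      omega
    · have hsub : (X.filter fun x => g x = o) ⊆ P.dependents o := by
        intro x hx
        obtain ⟨hxX, hgx⟩ := Finset.mem_filter.1 hx
        rcases hg x hxX with ⟨-, h⟩ | ⟨h, h'⟩
        · exact hgx ▸ h
        · exact absurd ⟨x, h, h'.symm.trans hgx⟩ ho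
      have h₁ := Finset.card_le_card hsub
      have h₂ := hD o
      omega
  refine solvableWith_of_query_finset X hXopen fun u hu => ?_
  refine (solvableWith_of_settled _ (P.reveal X u) rfl fun S hS =>
    Input.settled_reveal_of_cover hP hu hXcov hS).mono ?_
  rintro w _ hw ⟨M, rfl, hM⟩ F hF
  have hwP := hw.of_reveal hu
  have hMX : ∀ i ∈ M, i ∉ X := fun i hi => Input.notMem_of_not_isTrivial_reveal (hM i hi).1
  have hMopen : ∀ i ∈ M, ¬ P.IsTrivial i := fun i hi ht =>
    (hM i hi).1 (Input.reveal_isTrivial_of ht)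
  have hMman : ∀ i ∈ M, P.Mandatory w i := fun i hi => (hM i hi).2.of_reveal (hMX i hi)
  have hMF : ∀ i ∈ M, i ∈ F := fun i hi => (hMman i hi).mem_of_isFeasible hwP (hMopen i hi) hF
  have hFcov : ∀ i j, P.Adj i j → i ∈ F ∨ j ∈ F := fun i j h => h.mem_or_mem hwP hF
  -- F covers the edge from x to `g x`, so an x outside F is charged to an element of F.
  have hXF : (X \ F).card ≤ (γ - 1) * F.card := by
    refine Finset.card_le_mul_card_image_of_maps_to (f := g) (fun x hx => ?_) _ fun o _ => ?_
    · obtain ⟨hxX, hxF⟩ := Finset.mem_sdiff.1 hx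
      exact (hFcov _ _ (hgadj x hxX)).resolve_left hxF
    · have h₁ := Finset.card_le_card
        (Finset.filter_subset_filter (fun x => g x = o) (Finset.sdiff_subset (s := X) (t := F)))
      have h₂ := hfib o
      omega
  have hXM : (X ∩ F).card + M.card ≤ F.card := by
    rw [← Finset.card_union_of_disjoint]
    · exact Finset.card_le_card (Finset.union_subset Finset.inter_subset_right hMF)
    · exact Finset.disjoint_left.2 fun i hi hi' => hMX i hi' (Finset.mem_inter.1 hi).1
  have hXsplit := Finset.card_sdiff_add_card_inter X F
  have hrob : X.card + M.card ≤ γ * F.card := by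
    obtain ⟨c, rfl⟩ : ∃ c, γ = c + 1 := ⟨γ - 1, by omega⟩
    rw [Nat.add_sub_cancel] at hXF
    rw [Nat.add_mul]
    omega
  have hCF := hmin F fun i _ j _ h => hFcov i j h
  -- These intervals are mandatory for exactly one of the predicted and the true values, so each is
  -- the second component of an error.
  have hE : (P.predMandatory \ F).card + M.card ≤ (P.errors w).card := by
    rw [← Finset.card_union_of_disjoint]
    · refine (Finset.card_le_card fun i hi => ?_).trans
        (Finset.card_image_le (s := P.errors w) (f := Prod.snd))
      have : ∃ k, (k, i) ∈ P.errors w := by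
        rcases Finset.mem_union.1 hi with hi | hi
        · obtain ⟨hi, hiF⟩ := Finset.mem_sdiff.1 hi
          obtain ⟨ht, hman⟩ := Input.mem_predMandatory.1 hi
          exact Input.exists_error_of_mandatory_pred ht hman
            fun h => hiF (h.mem_of_isFeasible hwP ht hF)
        · exact Input.exists_error_of_mandatory (hMopen i hi) (hMman i hi) fun h =>
            hMX i hi (Finset.mem_union_left _ (Input.mem_predMandatory.2 ⟨hMopen i hi, h⟩))
      obtain ⟨k, hk⟩ := this
      exact Finset.mem_image.2 ⟨(k, i), hk, rfl⟩
    · exact Finset.disjoint_left.2 fun i hi hi' =>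
        hMX i hi' (Finset.mem_union_left _ (Finset.mem_sdiff.1 hi).1)
  have hcon : X.card + M.card ≤ F.card + (P.errors w).card := by
    have h₁ := Finset.card_union_le P.predMandatory C
    have h₂ := Finset.card_sdiff_add_card_inter P.predMandatory F
    have h₃ := Finset.card_sdiff_add_card_inter F P.predMandatory
    rw [Finset.inter_comm] at h₃
    rw [← hX] at h₁
    omega
  refine ⟨hrob, ?_, fun _ => by omega⟩
  exact Nat.mul_le_mul (Nat.le_succ γ) hcon

/-- If the value of o lies in all intervals of D, then p is mandatory, and F also contains o or q.
So F holds at least two of the γ + 1 queried intervals, and the elements of D outside F carry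
errors. Otherwise an x in D misses the value of o, which is an error, and only o and x are queried.
-/
theorem solvableWith_of_batch (hγ : 2 ≤ γ)
    (ih : ∀ P' : Input n, P'.openSet.card < P.openSet.card → SolvableWith P' (QueryBound γ P'))
    (hDo : D ⊆ P.dependents o) (hDcard : D.card + 1 = γ) (hp : p ∈ D)
    (hman : ∀ w, P.IsRealization w → P.lo p < w o → w o < P.hi p → P.Mandatory w p)
    (hq : q ∉ D) (hoq : P.Adj o q) : SolvableWith P (QueryBound γ P) := by
  classical
  have hoD : o ∉ D := fun h => (Input.mem_dependents.1 (hDo h)).2.1.ne rfl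
  have hot : ¬ P.IsTrivial o := hoq.not_isTrivial
  have hDt : ∀ i ∈ D, ¬ P.IsTrivial i := fun i hi =>
    (Input.mem_dependents.1 (hDo hi)).2.1.symm.not_isTrivial
  have key : ∀ (B : Finset (Fin n)) (u : Fin n → ℝ), P.IsRealization u → o ∉ B →
      (∀ i ∈ B, ¬ P.IsTrivial i) →
      (∀ w, P.IsRealization w → w o = u o → ∀ F, P.IsFeasible w F →
        ∃ f e, f ≤ (F ∩ insert o B).card ∧
        e ≤ ((P.errors w).filter fun x => x.1 ∈ insert o B ∨ x.2 ∈ insert o B).card ∧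
        B.card + 1 ≤ γ * f ∧ γ * (B.card + 1) ≤ (γ + 1) * (f + e) ∧
        (γ = 2 → 2 * (B.card + 1) ≤ 3 * f + 2 * e)) →
      SolvableWith (P.reveal {o} u) fun w k => QueryBound γ P w (k + 1) := by
    intro B u hu hoB hBt hB
    refine solvableWith_of_query_finset B ?_ fun v hv => ?_
    · intro i hi
      rw [Input.IsTrivial, Input.reveal_interval_of_notMem]
      · exact hBt i hi
      · rintro h
        rw [Finset.mem_singleton] at h
        exact hoB (h ▸ hi)
    · rw [hv.reveal_eq, Input.reveal_reveal, ← Finset.insert_eq]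
      have hvP := hv.of_reveal hu
      refine (ih _ (Input.card_openSet_reveal_lt (Finset.mem_insert_self o B) hot)).mono ?_
      intro w k hw hk
      have hwP := hw.of_reveal hvP
      have hwo : w o = u o := (hw.eq_of_mem (Finset.mem_insert_self o B)).trans
        (hv.eq_of_mem (Finset.mem_singleton_self o))
      rw [hw.reveal_eq] at hk
      have := hk.of_reveal hwP (by
        rw [Finset.card_insert_of_notMem hoB]
        exact hB w hwP hwo)
      rw [Finset.card_insert_of_notMem hoB] at this
      have heq : B.card + k + 1 = B.card + 1 + k := by omega
      rw [heq]; exact this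
  refine solvableWith_of_query hot fun u hu => ?_
  by_cases hall : ∀ x ∈ D, P.lo x < u o ∧ u o < P.hi x
  · refine key (insert q D) u hu ?_ ?_ ?_
    · rw [Finset.mem_insert, not_or]
      exact ⟨hoq.ne, hoD⟩
    · intro i hi
      rcases Finset.mem_insert.1 hi with rfl | hi
      · exact hoq.symm.not_isTrivial
      · exact hDt i hi
    intro w hw hwo F hF
    set B := insert o (insert q D) with hB
    have hDB : D ⊆ B := (Finset.subset_insert _ _).trans (Finset.subset_insert _ _)
    have hpF : p ∈ F := by
      obtain ⟨h₁, h₂⟩ := hall p hp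
      exact (hman w hw (hwo ▸ h₁) (hwo ▸ h₂)).mem_of_isFeasible hw (hDt p hp) hF
    obtain ⟨x, hxF, hxB, hxD⟩ : ∃ x ∈ F, x ∈ B ∧ x ∉ D := by
      rcases hoq.mem_or_mem hw hF with h | h
      · exact ⟨o, h, by simp [hB], hoD⟩
      · exact ⟨q, h, by simp [hB], hq⟩
    have hfcard : (D ∩ F).card + 1 ≤ (F ∩ B).card := by
      have hx : x ∉ D ∩ F := fun h => hxD (Finset.mem_inter.1 h).1
      rw [← Finset.card_insert_of_notMem hx]
      refine Finset.card_le_card fun y hy => ?_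
      rcases Finset.mem_insert.1 hy with rfl | hy
      · exact Finset.mem_inter.2 ⟨hxF, hxB⟩
      · obtain ⟨h₁, h₂⟩ := Finset.mem_inter.1 hy
        exact Finset.mem_inter.2 ⟨h₂, hDB h₁⟩
    have hpos : 1 ≤ (D ∩ F).card := Finset.card_pos.2 ⟨p, Finset.mem_inter.2 ⟨hp, hpF⟩⟩
    have hecard : (D \ F).card ≤
        ((P.errors w).filter fun x => x.1 ∈ B ∨ x.2 ∈ B).card := by
      refine (Finset.card_le_card fun i hi => ?_).trans
        (Finset.card_image_le (f := Prod.snd))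
      obtain ⟨hiD, hiF⟩ := Finset.mem_sdiff.1 hi
      obtain ⟨ht, hm⟩ := Input.mem_predMandatory.1 (Input.mem_dependents.1 (hDo hiD)).1
      obtain ⟨k, hk⟩ := Input.exists_error_of_mandatory_pred ht hm
        fun h => hiF (h.mem_of_isFeasible hw ht hF)
      exact Finset.mem_image.2 ⟨(k, i), Finset.mem_filter.2 ⟨hk, Or.inr (hDB hiD)⟩, rfl⟩
    have hsplit := Finset.card_sdiff_add_card_inter D F
    -- Here f + e = γ and f ≥ 2. For γ = 2, D is just p, so f = 2 and e = 0 for three queries, which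
    -- gives the ratio 3/2.
    refine ⟨(D ∩ F).card + 1, (D \ F).card, hfcard, hecard, ?_, ?_, fun h => ?_⟩
    · rw [Finset.card_insert_of_notMem hq, hDcard]
      nlinarith
    · rw [Finset.card_insert_of_notMem hq, hDcard, mul_comm]
      exact Nat.mul_le_mul_left _ (by omega)
    · rw [Finset.card_insert_of_notMem hq]
      omega
  · push Not at hall
    obtain ⟨x, hx, hxu⟩ := hall
    have hox : P.Adj o x := (Input.mem_dependents.1 (hDo hx)).2.1
    refine key {x} u hu ?_ ?_ ?_
    · rw [Finset.mem_singleton]; exact hox.ne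
    · intro i hi
      rw [Finset.mem_singleton.1 hi]
      exact hDt x hx
    intro w hw hwo F hF
    obtain ⟨-, -, h₁, h₂⟩ := Input.mem_dependents.1 (hDo hx)
    have herr : (o, x) ∈ P.errors w := by
      refine Input.mem_errors.2 ⟨hox.mem_neighbors, hDt x hx, ?_⟩
      by_cases hlo : P.lo x < w o
      · exact Or.inr (Or.inr ⟨h₂, hwo ▸ hxu (hwo ▸ hlo)⟩)
      · exact Or.inl (Or.inl ⟨not_lt.1 hlo, h₁⟩)
    -- Two queries are paid for by the edge between o and x and by the error of o at x.
    refine ⟨1, 1, Finset.card_pos.2 ?_, Finset.card_pos.2 ⟨(o, x), ?_⟩, ?_, ?_, ?_⟩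
    · rcases hox.mem_or_mem hw hF with h | h
      · exact ⟨o, by simp [h]⟩
      · exact ⟨x, by simp [h]⟩
    · simp [herr]
    · simpa using hγ
    · rw [Finset.card_singleton]; omega
    · intro _; simp

theorem solvableWith_queryBound (hγ : 2 ≤ γ) : ∀ (m : ℕ) (P : Input n), P.openSet.card = m →
    SolvableWith P (QueryBound γ P) := by
  classical
  intro m
  induction m using Nat.strong_induction_on with
  | _ m ih =>
    intro P hm
    subst hm
    by_cases hP : ∃ i, P.KnownMandatory i
    · obtain ⟨i, hi, hman⟩ := hP
      refine solvableWith_of_query hi fun u hu => ?_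
      refine (ih _ (Input.card_openSet_reveal_lt (Finset.mem_singleton_self i) hi) _ rfl).mono ?_
      intro w k hw hk
      have hwP := hw.of_reveal hu
      rw [hw.reveal_eq] at hk
      rw [add_comm]
      refine hk.of_reveal hwP fun F hF => ⟨1, 0, Finset.card_pos.2 ⟨i, ?_⟩, Nat.zero_le _, ?_⟩
      · simp [(hman w hwP).mem_of_isFeasible hwP hi hF]
      · rw [Finset.card_singleton]
        omega
    push Not at hP
    by_cases hstep : ∃ o q, (P.dependents o).card + 1 ≥ γ ∧ P.Adj o q ∧
        ((P.dependents o).card ≥ γ ∨ q ∉ P.predMandatory)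
    · obtain ⟨o, q, hcard, hoq, hor⟩ := hstep
      obtain ⟨p₀, hp₀⟩ : (P.dependents o).Nonempty := Finset.card_pos.1 (by omega)
      obtain ⟨p, hp, hman⟩ := Input.exists_dependent_forall_mandatory hp₀
      -- D has exactly γ - 1 elements, including the p that the value of o can force.
      obtain ⟨D, hpD, hDo, hD⟩ := Finset.exists_subsuperset_card_eq
        (Finset.singleton_subset_iff.2 hp) (n := γ - 1) (by rw [Finset.card_singleton]; omega)
        (by omega)
      obtain ⟨q', hq', hoq'⟩ : ∃ q' ∉ D, P.Adj o q' := by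
        rcases hor with h | h
        · obtain ⟨x, hx, hxD⟩ := Finset.exists_mem_notMem_of_card_lt_card
            (show D.card < (P.dependents o).card by omega)
          exact ⟨x, hxD, (Input.mem_dependents.1 hx).2.1⟩
        · exact ⟨q, fun hqD => h (Input.mem_dependents.1 (hDo hqD)).1, hoq⟩
      exact solvableWith_of_batch hγ (fun P' hP' => ih _ hP' P' rfl) hDo (by omega)
        (Finset.singleton_subset_iff.1 hpD) hman hq' hoq'
    · push Not at hstep
      refine solvableWith_of_card_dependents_le hγ hP (fun o => ?_) fun o q hqo hq => ?_
      · by_contra! hlt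
        obtain ⟨p, hp⟩ : (P.dependents o).Nonempty := Finset.card_pos.1 (by omega)
        have := (hstep o p (by omega) (Input.mem_dependents.1 hp).2.1).1
        omega
      · by_contra! hlt
        exact hq (hstep o q (by omega) hqo.symm).2

end Algorithm

end MinUncertainty

/-! ### From query bounds to competitive ratios. -/

/-- If `opt = 0`, both bounds say that the algorithm makes no query at all. -/
theorem mainTheorem3 :
    ∃ A : ℕ → MinUncertainty.QueryAlgorithm, ∀ γ : ℕ, 2 ≤ γ →
      (A γ).SolvesMinimum ∧
      (A γ).IsCompetitive (fun _ P w =>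
        min ((1 + 1 / (γ : ℝ)) * (1 + (P.hopDistance w : ℝ) / (P.opt w : ℝ))) (γ : ℝ)) ∧
      (γ = 2 → (A γ).IsCompetitive (fun _ P w =>
        min (3 / 2 + (P.hopDistance w : ℝ) / (P.opt w : ℝ)) 2)) := by
  classical
  have hex : ∀ (γ n : ℕ) (P : MinUncertainty.Input n),
      ∃ s : MinUncertainty.Strategy (Fin n) (MinUncertainty.Answer P), 2 ≤ γ →
        ∀ w, P.IsRealization w →
        (∀ S : {S : Finset (Fin n) // S ∈ P.sets},
          s.output w S ∈ S.1 ∧ ∀ j ∈ S.1, w (s.output w S) ≤ w j) ∧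
        (s.queries w).Nodup ∧ (∀ i ∈ s.queries w, ¬ P.IsTrivial i) ∧
        MinUncertainty.QueryBound γ P w (s.queries w).length := by
    intro γ n P
    by_cases hγ : 2 ≤ γ
    · obtain ⟨s, hs⟩ := MinUncertainty.solvableWith_queryBound hγ _ P rfl
      exact ⟨s, fun _ => hs⟩
    -- For γ < 2 nothing is claimed, so the strategy is arbitrary.
    · exact ⟨.answer fun S => (P.sets_nonempty S.1 S.2).choose, fun h => absurd h hγ⟩
  choose A hA using hex
  refine ⟨A, fun γ hγ => ?_⟩
  have hbound : ∀ (n : ℕ) (P : MinUncertainty.Input n) (w : Fin n → ℝ), P.IsRealization w →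
      ((A γ n P).queries w).length ≤ γ * P.opt w ∧
      γ * ((A γ n P).queries w).length ≤ (γ + 1) * (P.opt w + P.hopDistance w) ∧
      (γ = 2 → 2 * ((A γ n P).queries w).length ≤ 3 * P.opt w + 2 * P.hopDistance w) := by
    intro n P w hw
    obtain ⟨F, hF, hFc⟩ := P.exists_card_eq_opt w
    obtain ⟨h₁, h₂, h₃⟩ := (hA γ n P hγ w hw).2.2.2 F hF
    have hE := P.card_errors_le w
    rw [hFc] at h₁ h₂ h₃
    refine ⟨h₁, h₂.trans (Nat.mul_le_mul_left _ (Nat.add_le_add_left hE _)), fun h => ?_⟩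
    have := h₃ h
    omega
  have hγ0 : (0 : ℝ) < γ := by exact_mod_cast (by omega : 0 < γ)
  refine ⟨fun n P w hw => ?_, fun n P w hw => ?_, fun hγ2 n P w hw => ?_⟩
  · obtain ⟨h₁, h₂, h₃, -⟩ := hA γ n P hγ w hw
    exact ⟨h₁, h₂, h₃⟩
  · obtain ⟨h₁, h₂, -⟩ := hbound n P w hw
    rw [min_mul_of_nonneg _ _ (Nat.cast_nonneg _)]
    refine le_min ?_ (by exact_mod_cast h₁)
    -- For `opt = 0` the quotient is meaningless, but the factor γ bound already excludes any query.
    rcases Nat.eq_zero_or_pos (P.opt w) with h0 | hpos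
    · rw [h0] at h₁ ⊢
      simpa using h₁
    · have hpos' : (0 : ℝ) < P.opt w := by exact_mod_cast hpos
      have h₂' : (γ : ℝ) * ((A γ n P).queries w).length ≤
          (γ + 1) * (P.opt w + P.hopDistance w) := by exact_mod_cast h₂
      have : (1 + 1 / (γ : ℝ)) * (1 + (P.hopDistance w : ℝ) / (P.opt w : ℝ)) * (P.opt w : ℝ) =
          (γ + 1) * (P.opt w + P.hopDistance w) / γ := by
        field_simp
      rw [this, le_div_iff₀ hγ0, mul_comm]
      exact h₂'
  · obtain ⟨h₁, -, h₃⟩ := hbound n P w hw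
    rw [hγ2] at h₁ h₃ ⊢
    rw [min_mul_of_nonneg _ _ (Nat.cast_nonneg _)]
    refine le_min ?_ (by exact_mod_cast h₁)
    rcases Nat.eq_zero_or_pos (P.opt w) with h0 | hpos
    · rw [h0] at h₁ ⊢
      simpa using h₁
    · have hpos' : (0 : ℝ) < P.opt w := by exact_mod_cast hpos
      have h₃' : (2 : ℝ) * ((A 2 n P).queries w).length ≤
          3 * P.opt w + 2 * P.hopDistance w := by exact_mod_cast h₃ rfl
      rw [add_mul, div_mul_cancel₀ _ hpos'.ne']
      linarith
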